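/- Let $G$ be a non-abelian simple compact Lie group, that is, a compact (Hausdorff) connected non-abelian finite-dimensional real Lie group whose only closed connected normal subgroups are $1$ and $G$ (in particular, this covers the connected compact non-abelian Lie groups that are simple as abstract groups). For $x,g\in G$ write $[x,g]=x^{-1}g^{-1}xg$, and let $[x,{}_0g]=x$ and $[x,{}_{n+1}g]=[[x,{}_ng],g]$. An Engel sink of an element $g\in G$ is a set $\mathscr{E}(g)\subseteq G$ such that for every $x\in G$ there is a positive integer $n(x,g)$ with $[x,{}_ng]\in\mathscr{E}(g)$ for all $n\ge n(x,g)$. Then $G$ contains an element $g$ such that every Engel sink of $g$ is uncountable. -/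

import Mathlib

open scoped Manifold ContDiff

/-- The iterated commutator `[x, g, g, …, g]` with `g` repeated `n` times, left-normed, where
`[a, b] = a⁻¹ b⁻¹ a b`. -/
def engelCommutator {G : Type*} [Group G] (x g : G) : ℕ → G
  | 0 => x
  | n + 1 => (engelCommutator x g n)⁻¹ * g⁻¹ * engelCommutator x g n * g

/-- `S` is an Engel sink of `g`: for every `x` there is a positive integer `N` such that
`[x, g, …, g]` (`g` repeated `n` times) lies in `S` for all `n ≥ N`. -/
def IsEngelSink {G : Type*} [Group G] (g : G) (S : Set G) : Prop :=
  ∀ x : G, ∃ N : ℕ, 0 < N ∧ ∀ n : ℕ, N ≤ n → engelCommutator x g n ∈ S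

/-- Simplicity in the sense of Lie groups: the group is connected, nontrivial, and its only
closed connected normal subgroups are the trivial subgroup and the whole group. Every connected
group that is simple as an abstract group has this property; so do its connected finite covers,
such as `SU(2)`. -/
structure IsLieSimple (G : Type*) [Group G] [TopologicalSpace G] : Prop where
  connected : ConnectedSpace G
  nontrivial : Nontrivial G
  eq_bot_or_eq_top : ∀ N : Subgroup G, N.Normal → IsClosed (N : Set G) →
    IsConnected (N : Set G) → N = ⊥ ∨ N = ⊤

/-!
In any compact connected Hausdorff group, an element `g` with a countable Engel sink is central.
By the Baire category theorem, `x ↦ [x, g, …, g]` is constant on some nonempty open set for some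
number of repetitions of `g`. Composed with a finite-dimensional representation `ρ`, this map lies
in a finite-dimensional translation-invariant space of functions, and a function of that kind on a
connected group is determined by its values on any nonempty open set; hence `ρ [x, g, …, g] = 1` for
all `x`. The number of repetitions can then be brought down to one: if `ρ [x, g, g] = 1`, the powers
of `ρ [x, g]` are the elements `ρ [x, g ^ k]`, which for `x` near `1` all stay close to `1`, and
this forces `ρ [x, g] = 1`. By the Peter–Weyl theorem (averaging rank one operators on `L²(G)`
yields compact symmetric operators, whose eigenspaces are invariant) the finite-dimensional
representations separate the points of `G`, so `[x, g] = 1`.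
-/

section Representative

open Filter Topology

variable {k G M A : Type*} [Field k] [Group G] [AddCommGroup M] [Module k M]

variable (k) in
/-- A function on a group is *representative* if it lies in a finite-dimensional space of functions
stable under left translation. The values may lie in any vector space. -/
def IsRepresentative (f : G → M) : Prop :=
  ∃ W : Submodule k (G → M), FiniteDimensional k W ∧ f ∈ W ∧
    ∀ g : G, ∀ φ ∈ W, (fun x => φ (g * x)) ∈ W

namespace IsRepresentative

theorem sub {f f' : G → M} (hf : IsRepresentative k f) (hf' : IsRepresentative k f') :
    IsRepresentative k (f - f') := by
  obtain ⟨W, _, hfW, hW⟩ := hf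
  obtain ⟨W', _, hfW', hW'⟩ := hf'
  refine ⟨W ⊔ W', inferInstance,
    sub_mem (Submodule.mem_sup_left hfW) (Submodule.mem_sup_right hfW'), fun g φ hφ => ?_⟩
  obtain ⟨ψ, hψ, ψ', hψ', rfl⟩ := Submodule.mem_sup.1 hφ
  exact add_mem (Submodule.mem_sup_left (hW g ψ hψ)) (Submodule.mem_sup_right (hW' g ψ' hψ'))

theorem const (m : M) : IsRepresentative k (fun _ : G => m) := by
  refine ⟨k ∙ (fun _ => m), inferInstance, Submodule.mem_span_singleton_self _, fun g φ hφ => ?_⟩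
  obtain ⟨c, rfl⟩ := Submodule.mem_span_singleton.1 hφ
  exact hφ

variable [Ring A] [Algebra k A]

theorem mul {f f' : G → A} (hf : IsRepresentative k f) (hf' : IsRepresentative k f') :
    IsRepresentative k (f * f') := by
  obtain ⟨W, hWfin, hfW, hW⟩ := hf
  obtain ⟨W', hWfin', hfW', hW'⟩ := hf'
  refine ⟨W * W', Module.Finite.iff_fg.2 (.mul (.of_finite) (.of_finite)),
    Submodule.mul_mem_mul hfW hfW', fun g φ hφ => ?_⟩
  exact Submodule.mul_induction_on hφ
    (fun ψ hψ ψ' hψ' => Submodule.mul_mem_mul (hW g ψ hψ) (hW' g ψ' hψ'))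
    (fun φ φ' hφ hφ' => add_mem hφ hφ')

variable [FiniteDimensional k A] (ρ : G →* A)

theorem monoidHom : IsRepresentative k (fun x => ρ x) := by
  refine ⟨(LinearMap.pi fun x => LinearMap.mulRight k (ρ x)).range, inferInstance,
    ⟨1, by ext x; simp⟩, ?_⟩
  rintro g _ ⟨a, rfl⟩
  exact ⟨a * ρ g, by ext x; simp [mul_assoc]⟩

theorem monoidHom_inv : IsRepresentative k (fun x => ρ x⁻¹) := by
  refine ⟨(LinearMap.pi fun x => LinearMap.mulLeft k (ρ x⁻¹)).range, inferInstance,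
    ⟨1, by ext x; simp⟩, ?_⟩
  rintro g _ ⟨a, rfl⟩
  exact ⟨ρ g⁻¹ * a, by ext x; simp⟩

end IsRepresentative

/-- The functions vanishing in a neighbourhood of `x`. -/
def vanishingNear (k M : Type*) {X : Type*} [Semiring k] [AddCommMonoid M] [Module k M]
    [TopologicalSpace X] (x : X) : Submodule k (X → M) where
  carrier := {f | f =ᶠ[𝓝 x] 0}
  add_mem' hf hg := by simpa using hf.add hg
  zero_mem' := EventuallyEq.rfl
  smul_mem' c _ hf := by simpa using hf.const_smul c

theorem eventually_inf_vanishingNear_le {X : Type*} [TopologicalSpace X]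
    (W : Submodule k (X → M)) [FiniteDimensional k W] (x : X) :
    ∀ᶠ y in 𝓝 x, W ⊓ vanishingNear k M x ≤ W ⊓ vanishingNear k M y := by
  obtain ⟨s, hs⟩ : (W ⊓ vanishingNear k M x).FG := .of_finite
  have hsx : ∀ᶠ y in 𝓝 x, ∀ φ ∈ s, φ ∈ vanishingNear k M y :=
    (eventually_all_finset s).2 fun φ hφ => by
      have : φ ∈ W ⊓ vanishingNear k M x := hs ▸ Submodule.subset_span hφ
      exact eventually_eventuallyEq_nhds.2 this.2
  filter_upwards [hsx] with y hy
  exact le_inf inf_le_left (hs ▸ Submodule.span_le.2 hy)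

theorem finrank_inf_vanishingNear_eq [TopologicalSpace G] [ContinuousMul G]
    {W : Submodule k (G → M)} [FiniteDimensional k W]
    (hW : ∀ g : G, ∀ φ ∈ W, (fun x => φ (g * x)) ∈ W) (x y : G) :
    Module.finrank k ↥(W ⊓ vanishingNear k M x) = Module.finrank k ↥(W ⊓ vanishingNear k M y) := by
  suffices hle : ∀ x y : G, Module.finrank k ↥(W ⊓ vanishingNear k M x) ≤
      Module.finrank k ↥(W ⊓ vanishingNear k M y) from (hle x y).antisymm (hle y x)
  intro x y
  let τ : (G → M) →ₗ[k] G → M := LinearMap.funLeft k M (x * y⁻¹ * ·)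
  have hτ : Function.Injective τ :=
    LinearMap.funLeft_injective_of_surjective k M _ (mul_left_surjective (x * y⁻¹))
  have hmap : (W ⊓ vanishingNear k M x).map τ ≤ W ⊓ vanishingNear k M y := by
    rintro _ ⟨φ, ⟨hφW, hφx⟩, rfl⟩
    refine ⟨hW _ φ hφW, ?_⟩
    have : Tendsto (x * y⁻¹ * ·) (𝓝 y) (𝓝 x) := by
      simpa using (continuous_const_mul (x * y⁻¹)).tendsto y
    exact this.eventually hφx
  rw [(Submodule.equivMapOfInjective τ hτ _).finrank_eq]
  exact Submodule.finrank_mono hmap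

/-- In a finite-dimensional space of functions, those vanishing near `x` form a subspace that can
only grow when `x` moves a little; by translation its dimension does not depend on `x`, so it is
locally constant. -/
theorem IsRepresentative.eq_zero_of_eventuallyEq_zero [TopologicalSpace G] [ContinuousMul G]
    [PreconnectedSpace G] {f : G → M} (hf : IsRepresentative k f) {x₀ : G} (h : f =ᶠ[𝓝 x₀] 0) :
    f = 0 := by
  obtain ⟨W, _, hfW, hW⟩ := hf
  have hconst : IsLocallyConstant fun x => W ⊓ vanishingNear k M x :=
    (IsLocallyConstant.iff_eventually_eq _).2 fun x =>
      (eventually_inf_vanishingNear_le W x).mono fun y hle =>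
        (Submodule.eq_of_le_of_finrank_eq hle (finrank_inf_vanishingNear_eq hW x y)).symm
  ext x
  have hx₀ : f ∈ W ⊓ vanishingNear k M x₀ := ⟨hfW, h⟩
  rw [hconst.apply_eq_of_preconnectedSpace x₀ x] at hx₀
  exact hx₀.2.self_of_nhds

theorem IsRepresentative.eq_of_eventually_eq_const [TopologicalSpace G] [ContinuousMul G]
    [PreconnectedSpace G] {f : G → M} (hf : IsRepresentative k f) {x₀ : G} {m : M}
    (h : ∀ᶠ x in 𝓝 x₀, f x = m) (x : G) : f x = m :=
  sub_eq_zero.1 <| congrFun ((hf.sub (.const m)).eq_zero_of_eventuallyEq_zero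
    (h.mono fun _ hy => sub_eq_zero.2 hy)) x

end Representative

section Engel

open Filter Topology

variable {G : Type*} [Group G]

theorem map_engelCommutator {K : Type*} [Group K] (φ : G →* K) (x g : G) (n : ℕ) :
    φ (engelCommutator x g n) = engelCommutator (φ x) (φ g) n := by
  induction n with
  | zero => rfl
  | succ n ih => simp [engelCommutator, ih]

theorem engelCommutator_add (x g : G) (m n : ℕ) :
    engelCommutator x g (m + n) = engelCommutator (engelCommutator x g m) g n := by
  induction n with
  | zero => rfl
  | succ n ih => rw [← add_assoc, engelCommutator, engelCommutator, ih]

theorem engelCommutator_one_eq_one_iff {x g : G} : engelCommutator x g 1 = 1 ↔ Commute x g := by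
  rw [commute_iff_eq, engelCommutator, engelCommutator, mul_assoc, ← mul_inv_rev, inv_mul_eq_one,
    eq_comm]

theorem engelCommutator_pow_one {x g : G} (h : engelCommutator x g 2 = 1) (k : ℕ) :
    engelCommutator x (g ^ k) 1 = engelCommutator x g 1 ^ k := by
  have hcomm : Commute (engelCommutator x g 1) g := by
    rwa [← engelCommutator_one_eq_one_iff, ← engelCommutator_add]
  calc engelCommutator x (g ^ k) 1 = (x⁻¹ * g⁻¹ * x) ^ k * g ^ k := by
        simpa [engelCommutator] using (conj_pow (a := x⁻¹) (b := g⁻¹) (i := k)).symm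
    _ = (engelCommutator x g 1 * g⁻¹) ^ k * g ^ k := by simp [engelCommutator]
    _ = engelCommutator x g 1 ^ k := by simp [hcomm.inv_right.mul_pow]

@[simp] theorem engelCommutator_one_left (g : G) (n : ℕ) : engelCommutator 1 g n = 1 := by
  induction n with
  | zero => rfl
  | succ n ih => simp [engelCommutator, ih]

theorem continuous_engelCommutator [TopologicalSpace G] [IsTopologicalGroup G] (g : G) (n : ℕ) :
    Continuous fun x => engelCommutator x g n := by
  induction n with
  | zero => exact continuous_id
  | succ n ih => simp only [engelCommutator]; fun_prop

theorem isRepresentative_engelCommutator {k A : Type*} [Field k] [Ring A] [Algebra k A]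
    [FiniteDimensional k A] (ρ : G →* A) (g : G) (n : ℕ) :
    IsRepresentative k (fun x => ρ (engelCommutator x g n)) ∧
      IsRepresentative k (fun x => ρ (engelCommutator x g n)⁻¹) := by
  induction n with
  | zero => exact ⟨.monoidHom ρ, .monoidHom_inv ρ⟩
  | succ n ih =>
    obtain ⟨hval, hinv⟩ := ih
    constructor
    · simp only [engelCommutator, map_mul]
      exact ((hinv.mul (.const _)).mul hval).mul (.const _)
    · simp only [engelCommutator, mul_inv_rev, inv_inv, map_mul]
      exact (IsRepresentative.const _).mul (hinv.mul ((IsRepresentative.const _).mul hval))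

theorem IsEngelSink.exists_eventually_engelCommutator_eq [TopologicalSpace G]
    [IsTopologicalGroup G] [T1Space G] [BaireSpace G] {g : G} {S : Set G} (hS : IsEngelSink g S)
    (hc : S.Countable) :
    ∃ (n : ℕ) (s x₀ : G), ∀ᶠ x in 𝓝 x₀, engelCommutator x g (n + 1) = s := by
  have := hc.to_subtype
  obtain ⟨⟨n, s⟩, x₀, hx₀⟩ := nonempty_interior_of_iUnion_of_closed
    (f := fun p : ℕ × S => {x | engelCommutator x g (p.1 + 1) = p.2})
    (fun p => isClosed_singleton.preimage (continuous_engelCommutator g (p.1 + 1)))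
    (Set.eq_univ_of_forall fun x => by
      obtain ⟨N, -, h⟩ := hS x
      exact Set.mem_iUnion.2 ⟨(N, ⟨_, h (N + 1) N.le_succ⟩), rfl⟩)
  exact ⟨n, s, x₀, mem_interior_iff_mem_nhds.1 hx₀⟩

end Engel

section CommutatorPowers

open Filter Topology

theorem eq_one_of_forall_norm_pow_sub_one_le {A : Type*} [NormedRing A] [NormedAlgebra ℝ A] {a : A}
    {r : ℝ} (hr : r < 1) (h : ∀ k : ℕ, ‖a ^ k - 1‖ ≤ r) : a = 1 := by
  have hdouble (b : A) (hb : ‖b - 1‖ ≤ r) : (2 - r) * ‖b - 1‖ ≤ ‖b ^ 2 - 1‖ := by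
    have hsq : (2 : ℝ) • (b - 1) = (b ^ 2 - 1) - (b - 1) * (b - 1) := by
      rw [two_smul]; noncomm_ring
    have := calc
      2 * ‖b - 1‖ = ‖(b ^ 2 - 1) - (b - 1) * (b - 1)‖ := by
          rw [← hsq, norm_smul, Real.norm_ofNat]
      _ ≤ ‖b ^ 2 - 1‖ + ‖b - 1‖ * ‖b - 1‖ :=
          (norm_sub_le _ _).trans (by gcongr; exact norm_mul_le _ _)
      _ ≤ ‖b ^ 2 - 1‖ + r * ‖b - 1‖ := by gcongr
    linarith
  have hgrow (j : ℕ) : (2 - r) ^ j * ‖a - 1‖ ≤ ‖a ^ 2 ^ j - 1‖ := by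
    induction j with
    | zero => simp
    | succ j ih =>
      calc (2 - r) ^ (j + 1) * ‖a - 1‖ = (2 - r) * ((2 - r) ^ j * ‖a - 1‖) := by ring
        _ ≤ (2 - r) * ‖a ^ 2 ^ j - 1‖ := by gcongr; linarith
        _ ≤ ‖a ^ 2 ^ (j + 1) - 1‖ := by rw [pow_succ, pow_mul]; exact hdouble _ (h _)
  by_contra hne
  have hpos : 0 < ‖a - 1‖ := norm_pos_iff.2 (sub_ne_zero.2 hne)
  obtain ⟨j, hj⟩ := pow_unbounded_of_one_lt (r / ‖a - 1‖) (show 1 < 2 - r by linarith)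
  rw [div_lt_iff₀ hpos] at hj
  linarith [hgrow j, h (2 ^ j)]

theorem eventually_forall_engelCommutator_one_mem {G : Type*} [Group G] [TopologicalSpace G]
    [IsTopologicalGroup G] [CompactSpace G] {U : Set G} (hU : U ∈ 𝓝 (1 : G)) :
    ∀ᶠ x in 𝓝 (1 : G), ∀ g : G, engelCommutator x g 1 ∈ U := by
  simpa using isCompact_univ.eventually_forall_of_forall_eventually
    (x₀ := (1 : G)) (K := Set.univ) (P := fun x g => engelCommutator x g 1 ∈ U) fun g _ =>
      ContinuousAt.eventually_mem (f := fun z : G × G => engelCommutator z.1 z.2 1)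
        (by simp only [engelCommutator]; fun_prop) (by simpa using hU)

variable {G A : Type*} [Group G] [TopologicalSpace G] [IsTopologicalGroup G] [CompactSpace G]
  [NormedRing A] [NormedAlgebra ℝ A] {ρ : G →* A}

/-- When `ρ [[x, g], g] = 1`, the powers of `ρ [x, g]` are the values `ρ [x, g ^ k]`, which for `x`
near `1` are all close to `1` by compactness. -/
theorem eventually_forall_map_engelCommutator_one_eq_one (hρ : Continuous ρ) :
    ∀ᶠ x in 𝓝 (1 : G), ∀ g : G, ρ (engelCommutator x g 2) = 1 → ρ (engelCommutator x g 1) = 1 := by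
  have hU : {z | ‖ρ z - 1‖ < 1 / 2} ∈ 𝓝 (1 : G) :=
    (by fun_prop : Continuous fun z => ‖ρ z - 1‖).continuousAt.eventually_lt_const (by simp)
  filter_upwards [eventually_forall_engelCommutator_one_mem hU] with x hx g h
  refine eq_one_of_forall_norm_pow_sub_one_le (r := 1 / 2) (by norm_num) fun k => ?_
  have hpow : ρ (engelCommutator x (g ^ k) 1) = ρ (engelCommutator x g 1) ^ k := by
    have h' : ρ.toHomUnits (engelCommutator x g 2) = 1 := Units.ext h
    rw [map_engelCommutator] at h'
    have := engelCommutator_pow_one h' k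
    rw [← map_pow, ← map_engelCommutator, ← map_engelCommutator] at this
    simpa using congrArg Units.val this
  rw [← hpow]
  exact (hx (g ^ k)).le

theorem eventually_map_engelCommutator_one_eq_one (hρ : Continuous ρ) {g : G} {n : ℕ}
    (h : ∀ᶠ x in 𝓝 (1 : G), ρ (engelCommutator x g (n + 1)) = 1) :
    ∀ᶠ x in 𝓝 (1 : G), ρ (engelCommutator x g 1) = 1 := by
  induction n with
  | zero => exact h
  | succ n ih =>
    have htendsto : Tendsto (fun x => engelCommutator x g n) (𝓝 1) (𝓝 1) := by
      simpa using (continuous_engelCommutator g n).tendsto 1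
    refine ih ?_
    filter_upwards [h,
      htendsto.eventually (eventually_forall_map_engelCommutator_one_eq_one hρ)] with x hx himp
    rw [engelCommutator_add]
    exact himp g (by rwa [← engelCommutator_add])

theorem IsEngelSink.map_engelCommutator_one_eq_one [T2Space G] [ConnectedSpace G]
    [FiniteDimensional ℝ A] (hρ : Continuous ρ) {g : G} {S : Set G} (hS : IsEngelSink g S)
    (hc : S.Countable) (x : G) : ρ (engelCommutator x g 1) = 1 := by
  obtain ⟨n, s, x₀, hx₀⟩ := hS.exists_eventually_engelCommutator_eq hc
  have hconst (y : G) : ρ (engelCommutator y g (n + 1)) = ρ s :=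
    (isRepresentative_engelCommutator (k := ℝ) ρ g _).1.eq_of_eventually_eq_const
      (hx₀.mono fun _ h => congrArg ρ h) y
  have hs : ρ s = 1 := by rw [← hconst 1, engelCommutator_one_left, map_one]
  exact (isRepresentative_engelCommutator (k := ℝ) ρ g _).1.eq_of_eventually_eq_const
    (eventually_map_engelCommutator_one_eq_one hρ (.of_forall fun y => (hconst y).trans hs)) x

end CommutatorPowers

section UnitaryRepresentation

open MeasureTheory InnerProductSpace RealInnerProductSpace

theorem isCompactOperator_rankOne {𝕜 E F : Type*} [RCLike 𝕜] [NormedAddCommGroup E]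
    [NormedSpace 𝕜 E] [NormedAddCommGroup F] [InnerProductSpace 𝕜 F] (u : E) (v : F) :
    IsCompactOperator (rankOne 𝕜 u v) :=
  (isCompactOperator_of_locallyCompactSpace_rng
    (ContinuousLinearMap.toSpanSingleton 𝕜 u)).comp_clm (innerSL 𝕜 v)

variable {G H : Type*} [Group G] [TopologicalSpace G] [CompactSpace G]
  [NormedAddCommGroup H] [InnerProductSpace ℝ H] {π : G →* (H ≃ₗᵢ[ℝ] H)}

section Average

variable [MeasurableSpace G]

/-- The average over `G` of the rank one operators `u ↦ ⟪π x v, u⟫ π x v`, for a unitary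
representation `π`: a compact symmetric operator commuting with `π`. -/
noncomputable def averagedRankOne (μ : Measure G) (π : G →* (H ≃ₗᵢ[ℝ] H)) (v : H) : H →L[ℝ] H :=
  ∫ x, rankOne ℝ (π x v) (π x v) ∂μ

variable [BorelSpace G] (μ : Measure G)

theorem integrable_rankOne_orbit [IsFiniteMeasure μ] (hπ : ∀ v, Continuous fun x => π x v)
    (v : H) : Integrable (fun x => rankOne ℝ (π x v) (π x v)) μ :=
  Continuous.integrable_of_hasCompactSupport
    (((rankOne ℝ).continuous.comp (hπ v)).clm_apply (hπ v)) (.of_compactSpace _)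

variable [CompleteSpace H]

theorem isCompactOperator_averagedRankOne [IsProbabilityMeasure μ]
    (hπ : ∀ v, Continuous fun x => π x v) (v : H) : IsCompactOperator (averagedRankOne μ π v) :=
  (compactOperator (RingHom.id ℝ) H H).convex.integral_mem isClosed_setOfPred_isCompactOperator
    (.of_forall fun _ => isCompactOperator_rankOne _ _) (integrable_rankOne_orbit μ hπ v)

variable [IsFiniteMeasure μ]

theorem inner_averagedRankOne (hπ : ∀ v, Continuous fun x => π x v) (v u w : H) :
    ⟪averagedRankOne μ π v u, w⟫ = ∫ x, ⟪π x v, u⟫ * ⟪π x v, w⟫ ∂μ := by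
  have hint := integrable_rankOne_orbit μ hπ v
  rw [averagedRankOne, ContinuousLinearMap.integral_apply hint, real_inner_comm,
    ← integral_inner (hint.apply_continuousLinearMap u)]
  simp [real_inner_smul_right, real_inner_comm w]

theorem isSymmetric_averagedRankOne (hπ : ∀ v, Continuous fun x => π x v) (v : H) :
    (averagedRankOne μ π v : H →ₗ[ℝ] H).IsSymmetric := fun u w => by
  rw [ContinuousLinearMap.coe_coe, real_inner_comm _ u, inner_averagedRankOne μ hπ,
    inner_averagedRankOne μ hπ]
  simp only [mul_comm]

theorem inner_eq_zero_of_averagedRankOne_apply_eq_zero [μ.IsOpenPosMeasure]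
    (hπ : ∀ v, Continuous fun x => π x v) {v u : H} (h : averagedRankOne μ π v u = 0) :
    ⟪v, u⟫ = 0 := by
  have hint : ∫ x, ⟪π x v, u⟫ * ⟪π x v, u⟫ ∂μ = 0 := by
    rw [← inner_averagedRankOne μ hπ, h, inner_zero_left]
  have hcont : Continuous fun x => ⟪π x v, u⟫ * ⟪π x v, u⟫ := by fun_prop
  have hzero : (fun x => ⟪π x v, u⟫ * ⟪π x v, u⟫) = 0 :=
    (hcont.ae_eq_iff_eq μ continuous_zero).1 <|
      (integral_eq_zero_iff_of_nonneg (fun x => mul_self_nonneg _)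
        (hcont.integrable_of_hasCompactSupport (.of_compactSpace _))).1 hint
  simpa using congrFun hzero 1

variable [IsTopologicalGroup G]

theorem averagedRankOne_apply_map [μ.IsMulLeftInvariant] (hπ : ∀ v, Continuous fun x => π x v)
    (v : H) (g : G) (u : H) :
    averagedRankOne μ π v (π g u) = π g (averagedRankOne μ π v u) := by
  refine ext_inner_right ℝ fun w => ?_
  obtain ⟨w, rfl⟩ := (π g).surjective w
  rw [LinearIsometryEquiv.inner_map_map, inner_averagedRankOne μ hπ, inner_averagedRankOne μ hπ,
    ← integral_mul_left_eq_self _ g]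
  simp only [map_mul, LinearIsometryEquiv.coe_mul, Function.comp_apply,
    LinearIsometryEquiv.inner_map_map]

end Average

/-- The eigenspaces of the averaged operator are invariant and span a dense subspace, and those for
nonzero eigenvalues are finite-dimensional, while its kernel is orthogonal to `v`. -/
theorem apply_eq_self_of_forall_finiteDimensional [IsTopologicalGroup G] [CompleteSpace H]
    (hπ : ∀ v, Continuous fun x => π x v) {a : G}
    (ha : ∀ W : Submodule ℝ H, FiniteDimensional ℝ W → (∀ g, ∀ w ∈ W, π g w ∈ W) →
      ∀ w ∈ W, π a w = w) (v : H) : π a v = v := by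
  borelize G
  let μ : Measure G := Measure.haarMeasure ⊤
  have : IsProbabilityMeasure μ := ⟨Measure.haarMeasure_self⟩
  let T := averagedRankOne μ π v
  have hT : IsCompactOperator T := isCompactOperator_averagedRankOne μ hπ v
  have hTsymm : (T : H →ₗ[ℝ] H).IsSymmetric := isSymmetric_averagedRankOne μ hπ v
  have hinv (c : ℝ) (g : G) (u : H) (hu : u ∈ Module.End.eigenspace (T : H →ₗ[ℝ] H) c) :
      π g u ∈ Module.End.eigenspace (T : H →ₗ[ℝ] H) c := by
    rw [Module.End.mem_eigenspace_iff, ContinuousLinearMap.coe_coe] at hu ⊢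
    rw [averagedRankOne_apply_map μ hπ, hu, map_smul]
  have hker (u : H) (hu : u ∈ Module.End.eigenspace (T : H →ₗ[ℝ] H) 0) : ⟪v, u⟫ = 0 :=
    inner_eq_zero_of_averagedRankOne_apply_eq_zero μ hπ (by simpa using hu)
  have hinner (c : ℝ) (u : H) (hu : u ∈ Module.End.eigenspace (T : H →ₗ[ℝ] H) c) :
      ⟪v, π a u⟫ = ⟪v, u⟫ := by
    obtain rfl | hc := eq_or_ne c 0
    · rw [hker _ (hinv 0 a u hu), hker u hu]
    · rw [ha _ (T.finite_dimensional_eigenspace hT c hc) (hinv c) u hu]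
  have horth : (π a).symm v - v ∈ (⨆ c, Module.End.eigenspace (T : H →ₗ[ℝ] H) c)ᗮ := by
    simp only [← Submodule.iInf_orthogonal, Submodule.mem_iInf]
    refine fun c => (Submodule.mem_orthogonal' _ _).2 fun u hu => ?_
    rw [inner_sub_left, LinearIsometryEquiv.inner_map_eq_flip, LinearIsometryEquiv.symm_symm,
      hinner c u hu, sub_self]
  rw [T.orthogonalComplement_iSup_eigenspaces_eq_bot hT hTsymm, Submodule.mem_bot, sub_eq_zero,
    LinearIsometryEquiv.symm_apply_eq] at horth
  exact horth.symm

end UnitaryRepresentation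

section RegularRepresentation

open MeasureTheory

variable {G : Type*} [Group G] [TopologicalSpace G] [IsTopologicalGroup G] [MeasurableSpace G]
  [BorelSpace G] (μ : Measure G) [μ.IsMulLeftInvariant]

/-- The left regular representation on `L²(G)`, sending `f` to `x ↦ f (g⁻¹ * x)`. -/
noncomputable def leftRegular : G →* (Lp ℝ 2 μ ≃ₗᵢ[ℝ] Lp ℝ 2 μ) where
  toFun g :=
    { DistribMulAction.toLinearEquiv ℝ (Lp ℝ 2 μ) (DomMulAct.mk g⁻¹) with
      norm_map' := DomMulAct.norm_smul_Lp _ }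
  map_one' := by
    ext1 f
    change DomMulAct.mk (1 : G)⁻¹ • f = f
    rw [inv_one, DomMulAct.mk_one, one_smul]
  map_mul' g h := by
    ext1 f
    change DomMulAct.mk (g * h)⁻¹ • f = DomMulAct.mk g⁻¹ • DomMulAct.mk h⁻¹ • f
    rw [mul_inv_rev, DomMulAct.mk_mul, mul_smul]

theorem leftRegular_apply (g : G) (f : Lp ℝ 2 μ) : leftRegular μ g f = DomMulAct.mk g⁻¹ • f := rfl

theorem continuous_leftRegular_apply [IsLocallyFiniteMeasure μ] [μ.InnerRegularCompactLTTop]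
    (f : Lp ℝ 2 μ) : Continuous fun g => leftRegular μ g f :=
  have : Fact ((2 : ENNReal) ≠ ⊤) := ⟨ENNReal.ofNat_ne_top⟩
  (DomMulAct.continuous_mk.comp continuous_inv).smul continuous_const

theorem leftRegular_toLp [CompactSpace G] [IsFiniteMeasure μ] (g : G) (f : C(G, ℝ)) :
    leftRegular μ g (ContinuousMap.toLp 2 μ ℝ f) =
      ContinuousMap.toLp 2 μ ℝ (f.comp (ContinuousMap.mulLeft g⁻¹)) :=
  rfl

theorem leftRegular_injective [CompactSpace G] [T2Space G] [IsFiniteMeasure μ]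
    [μ.IsOpenPosMeasure] : Function.Injective (leftRegular μ) := by
  refine (injective_iff_map_eq_one _).2 fun a ha => ?_
  by_contra hne
  obtain ⟨f, hf, hfa⟩ := separatesPoints_continuous_of_t35Space (inv_ne_one.2 hne)
  have htranslate : (⟨f, hf⟩ : C(G, ℝ)).comp (ContinuousMap.mulLeft a⁻¹) = ⟨f, hf⟩ := by
    rw [← ContinuousMap.toLp_inj μ (p := 2) (𝕜 := ℝ), ← leftRegular_toLp, ha,
      LinearIsometryEquiv.coe_one, id]
  exact hfa (by simpa using DFunLike.congr_fun htranslate 1)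

end RegularRepresentation

section Restriction

variable {G H : Type*} [Group G] [NormedAddCommGroup H] [InnerProductSpace ℝ H]

/-- The restriction of `π` to an invariant subspace `W`, with values in the normed
algebra `W →L[ℝ] W`. -/
noncomputable def subrepresentation (π : G →* (H ≃ₗᵢ[ℝ] H)) (W : Submodule ℝ H)
    (hW : ∀ g, ∀ w ∈ W, π g w ∈ W) : G →* (W →L[ℝ] W) where
  toFun g := (π g : H →L[ℝ] H).restrict (hW g)
  map_one' := by ext; simp
  map_mul' g h := by ext w; exact congrArg (· (w : H)) (map_mul π g h)

theorem continuous_subrepresentation [TopologicalSpace G] {π : G →* (H ≃ₗᵢ[ℝ] H)}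
    (hπ : ∀ v, Continuous fun x => π x v) (W : Submodule ℝ H) [FiniteDimensional ℝ W]
    (hW : ∀ g, ∀ w ∈ W, π g w ∈ W) : Continuous (subrepresentation π W hW) :=
  continuous_clm_apply.2 fun w => (hπ w).subtype_mk _

end Restriction

section CompactGroup

universe u

variable {G : Type u} [Group G] [TopologicalSpace G] [IsTopologicalGroup G] [CompactSpace G]
  [T2Space G]

theorem eq_one_of_forall_finiteDimensional_representation {a : G}
    (ha : ∀ (A : Type u) [NormedRing A] [NormedAlgebra ℝ A] [FiniteDimensional ℝ A] (ρ : G →* A),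
      Continuous ρ → ρ a = 1) : a = 1 := by
  borelize G
  let μ : MeasureTheory.Measure G := MeasureTheory.Measure.haarMeasure ⊤
  have hπ := continuous_leftRegular_apply μ
  refine leftRegular_injective μ (LinearIsometryEquiv.ext ?_)
  rw [map_one]
  refine apply_eq_self_of_forall_finiteDimensional hπ fun W _ hW w hw => ?_
  have hW_one : subrepresentation (leftRegular μ) W hW a = 1 :=
    ha (W →L[ℝ] W) _ (continuous_subrepresentation hπ W hW)
  exact congrArg Subtype.val (DFunLike.congr_fun hW_one ⟨w, hw⟩)

theorem IsEngelSink.mem_center_of_countable [ConnectedSpace G] {g : G} {S : Set G}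
    (hS : IsEngelSink g S) (hc : S.Countable) : g ∈ Subgroup.center G := by
  refine Subgroup.mem_center_iff.2 fun x => engelCommutator_one_eq_one_iff.1 ?_
  exact eq_one_of_forall_finiteDimensional_representation fun A _ _ _ ρ hρ =>
    hS.map_engelCommutator_one_eq_one hρ hc x

end CompactGroup

theorem mainTheorem10_general {G : Type*} [Group G] [TopologicalSpace G] [IsTopologicalGroup G]
    [CompactSpace G] [T2Space G] [ConnectedSpace G] (hnonab : ∃ a b : G, a * b ≠ b * a) :
    ∃ g : G, ∀ S : Set G, IsEngelSink g S → ¬ S.Countable := by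
  obtain ⟨a, b, hab⟩ := hnonab
  exact ⟨b, fun S hS hc => hab (Subgroup.mem_center_iff.1 (hS.mem_center_of_countable hc) a)⟩

theorem mainTheorem10
    {E : Type*} [NormedAddCommGroup E] [NormedSpace ℝ E] [FiniteDimensional ℝ E]
    {H : Type*} [TopologicalSpace H] (I : ModelWithCorners ℝ E H) [I.Boundaryless]
    {G : Type*} [Group G] [TopologicalSpace G] [ChartedSpace H G] [LieGroup I ∞ G]
    [T2Space G] [CompactSpace G]
    (hsimple : IsLieSimple G) (hnonab : ∃ a b : G, a * b ≠ b * a) :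
    ∃ g : G, ∀ S : Set G, IsEngelSink g S → ¬ S.Countable := by
  have := topologicalGroup_of_lieGroup I ∞ (G := G)
  have := hsimple.connected
  exact mainTheorem10_general hnonab
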